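/- Define integers $t_{i,j}(n)$ for $n\ge 1$ and $i,j\in\mathbb Z$ by $t_{2,0}(1)=1$, by the recurrence $$t_{i,j}(n)=(i-2)\,t_{i-1,j}(n-1)+t_{i-1,j-1}(n-1)+(i-3)\,t_{i-2,j}(n-1)$$ for $n\ge 2$, $n+1\le i\le 2n$ and $0\le j\le 2n-i$, and by $t_{i,j}(n)=0$ in all other cases (that is, if $i\le n$ or $j<0$ or $i+j>2n$). Let $$U(x,\sigma_1,\sigma_2,\dots)=1-\sum_{m=1}^\infty x^m\sum_{i=m+1}^{2m}\sigma_i\sum_{j=0}^{2m-i}t_{i,j}(m)(-\sigma_1)^j,$$ a formal power series in $x$ with coefficients in $\mathbb Z[\sigma_1,\sigma_2,\dots]$. Let $G$ be a finite group with $N$ elements and identity $e$. A packing of subsets $\mathcal S_1,\dots,\mathcal S_n$ of $G$ is an element $(g_1,\dots,g_n)\in G^n$ such that the left translates $g_1\mathcal S_1,\dots,g_n\mathcal S_n$ are pairwise disjoint. The family $\mathcal S_1,\dots,\mathcal S_n$ is called generic if $h_{i_1}h_{i_2}\cdots h_{i_k}\neq e$ for every $k\ge 1$, every sequence $i_1,\dots,i_k$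 of $k$ distinct elements of $\{1,\dots,n\}$ and every choice of elements $h_{i_j}\in\mathcal S_{i_j}^{-1}\mathcal S_{i_j}\setminus\{e\}$. **Theorem.** The number of packings of a generic family $\mathcal S_1,\dots,\mathcal S_n$ of $n$ non-empty subsets of a finite group $G$ with $N$ elements equals $$N^n\,U(N^{-1},\sigma_1,\sigma_2,\dots),\qquad\text{where}\quad \sum_{j=0}^\infty\sigma_jt^j=\prod_{k=1}^n\bigl(1+\#(\mathcal S_k)\,t\bigr).$$ Moreover, for all integers $s_1,\dots,s_n\ge 1$, with $\sum_j\sigma_jt^j=\prod_{k=1}^n(1+s_kt)$, the coefficient of $x^m$ in $U(x,\sigma_1,\sigma_2,\dots)$ is zero for all $m\ge\max(n,1)$, and there is a polynomial $P\in\mathbb Z[X]$ of degree $n$, depending only on $s_1,\dots,s_n$, such that $P(N)=N^nU(N^{-1},\sigma_1,\sigma_2,\dots)$ for every integer $N\ge1$, and such that every generic family $\mathcal S_1,\dots,\mathcal S_n$ with $\#(\mathcal S_k)=s_k$ for all $k$ in a finite group $G$ has exactly $P(\#(G))$ packings. -/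

import Mathlib

open scoped Pointwise

universe u

namespace GroupPacking

/-- The integers `t_{i,j}(n)`, as `t n i j`. They are zero unless `n ≥ 1`, `i > n`, `j ≥ 0` and
`i + j ≤ 2 n`. -/
def t : ℕ → ℤ → ℤ → ℤ
  | 0, _, _ => 0
  | 1, i, j => if i = 2 ∧ j = 0 then 1 else 0
  | n + 2, i, j =>
      if ((n + 2 : ℕ) : ℤ) < i ∧ 0 ≤ j ∧ i + j ≤ 2 * ((n + 2 : ℕ) : ℤ) then
        (i - 2) * t (n + 1) (i - 1) j + t (n + 1) (i - 1) (j - 1)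
          + (i - 3) * t (n + 1) (i - 2) j
      else 0

/-- The formal power series
`U = 1 - ∑_{n ≥ 1} x^n ∑_{i=n+1}^{2n} σ_i ∑_{j=0}^{2n-i} t_{i,j}(n) (-σ_1)^j`
over `ℤ[σ_1, σ_2, …]`. The indeterminate `σ_i` is `MvPolynomial.X i`; the index `0` never occurs.
For `n = 0` the range of `i` is empty, so the subtracted series has no constant term. -/
noncomputable def U : PowerSeries (MvPolynomial ℕ ℤ) :=
  1 - PowerSeries.mk fun n : ℕ =>
    ∑ i ∈ Finset.Icc (n + 1) (2 * n), MvPolynomial.X i *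
      ∑ j ∈ Finset.range (2 * n - i + 1),
        MvPolynomial.C (t n (i : ℤ) (j : ℤ)) * (-MvPolynomial.X 1) ^ j

/-- The series `U(x, σ_1, σ_2, …)` in `x` for given integer values of the `σ_i`. -/
noncomputable def specializedU (σ : ℕ → ℤ) : PowerSeries ℤ :=
  PowerSeries.map (MvPolynomial.eval σ) U

/-- The value of `U(x, σ_1, σ_2, …)` at a real number `x` and integers `σ_i`. -/
noncomputable def evalU (x : ℝ) (σ : ℕ → ℤ) : ℝ :=
  ∑' m : ℕ, ((PowerSeries.coeff m (specializedU σ) : ℤ) : ℝ) * x ^ m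

/-- The numbers `σ_j` defined by `∑_j σ_j t^j = ∏_k (1 + s_k t)`. -/
noncomputable def sigma {n : ℕ} (s : Fin n → ℕ) (j : ℕ) : ℤ :=
  (∏ k : Fin n, (1 + Polynomial.C (s k : ℤ) * Polynomial.X)).coeff j

section Group

variable {G : Type*} [Group G] {n : ℕ}

/-- `(g_1, …, g_n)` is a packing of `S_1, …, S_n` if the left translates `g_i S_i` are pairwise
disjoint. -/
def IsPacking (S : Fin n → Set G) (g : Fin n → G) : Prop :=
  Pairwise fun i j => Disjoint (g i • S i) (g j • S j)

/-- The number of packings of a family of subsets of a finite group. -/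
noncomputable def numPackings (S : Fin n → Set G) : ℕ :=
  Nat.card {g : Fin n → G // IsPacking S g}

/-- Genericity: `h_{i_1} ⋯ h_{i_k} ≠ 1` for every non-empty sequence `i_1, …, i_k` of distinct
indices and all `h_i ∈ S_i⁻¹ S_i \ {1}`. -/
def IsGeneric (S : Fin n → Set G) : Prop :=
  ∀ l : List (Fin n), l ≠ [] → l.Nodup → ∀ h : Fin n → G,
    (∀ i ∈ l, h i ∈ ((S i)⁻¹ * S i) \ {1}) → (l.map h).prod ≠ 1

end Group

end GroupPacking

/-!
By genericity, overlapping translates of two members of the family share exactly one point. So if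
`a ∉ A`, a packing of `A, S_1, …, S_n` either is a packing of `A ∪ {a}, S_1, …, S_n`, or
`g_0 a = g_i b` for exactly one `i` and one `b ∈ S_i`, and in the latter case it is a packing of
the family in which `S_i` is replaced by the disjoint union `S_i ∪ b a⁻¹ A`. That family is again
generic, so the number of packings satisfies a recursion in the cardinalities. With `r = #A`,
`s_i = #S_i` and `p = ∏ (1 + s_k X)`, summing over `i` and `b` turns `p` into
`∑ s_i (1 + (r + s_i) X) ∏_{k ≠ i} (1 + s_k X) = (∑ s_i) p + r X p'`. The coefficients of `U` obey
the same recursion: the operator `p ↦ X p'` multiplies `σ_i` by `i`, which accounts for the factors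
`i - 2` and `i - 3` in the recurrence for `t`.
-/

namespace GroupPacking

section Algebra

open Polynomial

theorem t_eq_zero {n : ℕ} {i j : ℤ} (h : i ≤ n ∨ j < 0 ∨ 2 * (n : ℤ) < i + j) : t n i j = 0 := by
  match n with
  | 0 => rfl
  | 1 => exact if_neg (by push_cast at h; omega)
  | n + 2 => exact if_neg (by omega)

theorem t_add_two (n : ℕ) (i j : ℤ) :
    t (n + 2) i j = (i - 2) * t (n + 1) (i - 1) j + t (n + 1) (i - 1) (j - 1)
      + (i - 3) * t (n + 1) (i - 2) j := by
  rw [t]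
  split_ifs with h
  · rfl
  · rw [t_eq_zero (n := n + 1) (i := i - 1) (j := j) (by push_cast at h ⊢; omega),
      t_eq_zero (n := n + 1) (i := i - 1) (j := j - 1) (by push_cast at h ⊢; omega),
      t_eq_zero (n := n + 1) (i := i - 2) (j := j) (by push_cast at h ⊢; omega)]
    ring

/-- The polynomial `∑_j t_{i,j}(n) X^j`. All its terms are listed, since `t_{i,j}(n) ≠ 0` forces
`j ≤ 2 n - i < n`. -/
noncomputable def rowPoly (n : ℕ) (i : ℤ) : ℤ[X] :=
  ∑ j ∈ Finset.range n, monomial j (t n i j)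

theorem coeff_rowPoly (n : ℕ) (i : ℤ) (j : ℕ) : (rowPoly n i).coeff j = t n i j := by
  simp only [rowPoly, finsetSum_coeff, coeff_monomial, Finset.sum_ite_eq', Finset.mem_range,
    ite_eq_left_iff]
  exact fun hj => (t_eq_zero (by omega)).symm

theorem rowPoly_eq_zero {n : ℕ} {i : ℤ} (h : i ≤ n ∨ 2 * (n : ℤ) < i) : rowPoly n i = 0 := by
  ext j
  rw [coeff_rowPoly, t_eq_zero (by omega), coeff_zero]

theorem eval_rowPoly (n i : ℕ) (y : ℤ) :
    (rowPoly n i).eval y = ∑ j ∈ Finset.range (2 * n - i + 1), t n i j * y ^ j := by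
  have hdeg : (rowPoly n i).natDegree ≤ 2 * n - i :=
    natDegree_le_iff_coeff_eq_zero.2 fun j hj => by
      rw [coeff_rowPoly, t_eq_zero (by omega)]
  rw [eval_eq_sum_range' (Nat.lt_succ_of_le hdeg)]
  simp only [coeff_rowPoly]

theorem rowPoly_one (i : ℤ) : rowPoly 1 i = if i = 2 then 1 else 0 := by
  simp [rowPoly, t, apply_ite]

theorem rowPoly_add_two (n : ℕ) (i : ℤ) :
    rowPoly (n + 2) i
      = (C (i - 2) + X) * rowPoly (n + 1) (i - 1) + C (i - 3) * rowPoly (n + 1) (i - 2) := by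
  ext (_ | j)
  · rw [coeff_rowPoly, t_add_two, t_eq_zero (j := _ - 1) (by simp)]
    simp [coeff_rowPoly, add_mul, mul_coeff_zero]
  · simp only [coeff_rowPoly, t_add_two, add_mul, coeff_add, coeff_C_mul, coeff_X_mul,
      Nat.cast_succ, add_sub_cancel_right]

-- The recurrence fails only for `rowPoly 1 2`, and there the factor `i - 2` vanishes.
theorem mul_rowPoly_succ (n : ℕ) (i : ℤ) :
    C (i - 2) * rowPoly (n + 1) i
      = C (i - 2) * ((C (i - 2) + X) * rowPoly n (i - 1) + C (i - 3) * rowPoly n (i - 2)) := by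
  cases n with
  | zero =>
    obtain rfl | hi := eq_or_ne i 2
    · simp
    · rw [rowPoly_one, if_neg hi]
      simp [rowPoly]
  | succ n => rw [rowPoly_add_two]

theorem eval_add_one_rowPoly_succ (n : ℕ) (i y : ℤ) :
    (rowPoly (n + 1) i).eval (y + 1)
      = (rowPoly (n + 1) i).eval y + (i - 2) * (rowPoly n (i - 1)).eval (y + 1) := by
  induction n generalizing i with
  | zero => simp [rowPoly]
  | succ n ih =>
    have recurrence := congrArg (eval (y + 1)) (mul_rowPoly_succ n (i - 1))
    have ih₁ := ih (i - 1)
    have ih₂ := ih (i - 2)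
    simp only [rowPoly_add_two, eval_add, eval_mul, eval_C, eval_X] at recurrence ⊢
    ring_nf at recurrence ih₁ ih₂ ⊢
    linear_combination (i - 2 + y) * ih₁ + (i - 3) * ih₂ - recurrence

/-- The linear functional sending `∑_i p_i X^i` to `∑_i p_i ∑_j t_{i,j}(n) y^j`. For `n ≥ 1` and
`y = -p_1` this is minus the coefficient of `x^n` in `U(x, p_1, p_2, …)`; freeing `y` makes it
linear in `p`. -/
noncomputable def rowPairing (n : ℕ) (y : ℤ) : ℤ[X] →ₗ[ℤ] ℤ :=
  lsum fun i => (rowPoly n i).eval y • LinearMap.id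

theorem rowPairing_monomial (n : ℕ) (y : ℤ) (i : ℕ) (a : ℤ) :
    rowPairing n y (monomial i a) = (rowPoly n i).eval y * a := by
  simp [rowPairing, lsum_apply]

theorem coeff_specializedU (m : ℕ) (σ : ℕ → ℤ) :
    PowerSeries.coeff m (specializedU σ)
      = (if m = 0 then 1 else 0)
        - ∑ i ∈ Finset.Icc (m + 1) (2 * m), σ i * (rowPoly m i).eval (-σ 1) := by
  simp only [specializedU, U, map_sub, map_one, PowerSeries.coeff_one, PowerSeries.coeff_map,
    PowerSeries.coeff_mk, map_sum, map_mul, map_pow, map_neg, MvPolynomial.eval_X,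
    MvPolynomial.eval_C, ← eval_rowPoly]

theorem coeff_zero_specializedU (σ : ℕ → ℤ) : PowerSeries.coeff 0 (specializedU σ) = 1 := by
  simp [coeff_specializedU]

theorem coeff_one_specializedU (σ : ℕ → ℤ) : PowerSeries.coeff 1 (specializedU σ) = -σ 2 := by
  simp [coeff_specializedU, rowPoly_one]

theorem coeff_specializedU_eq_zero {σ : ℕ → ℤ} {m : ℕ} (hm : m ≠ 0) (hσ : ∀ i, m < i → σ i = 0) :
    PowerSeries.coeff m (specializedU σ) = 0 := by
  rw [coeff_specializedU, if_neg hm, zero_sub, neg_eq_zero]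
  refine Finset.sum_eq_zero fun i hi => ?_
  rw [hσ i (Finset.mem_Icc.1 hi).1, zero_mul]

theorem coeff_succ_specializedU (n : ℕ) (p : ℤ[X]) :
    PowerSeries.coeff (n + 1) (specializedU p.coeff) = -rowPairing (n + 1) (-p.coeff 1) p := by
  rw [coeff_specializedU, if_neg n.succ_ne_zero, zero_sub, rowPairing, lsum_apply, sum_def]
  congr 1
  refine Finset.sum_congr_of_eq_on_inter (fun i _ hi => ?_) (fun i _ hi => ?_) fun i _ _ => ?_
  · rw [notMem_support_iff.1 hi, zero_mul]
  · rw [Finset.mem_Icc] at hi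
    simp [rowPoly_eq_zero (n := n + 1) (i := i) (by omega)]
  · simp [mul_comm]

theorem rowPairing_add_two (n : ℕ) (r y : ℤ) (p : ℤ[X]) :
    rowPairing (n + 2) y ((1 + C (r + 1) * X) * p)
      = rowPairing (n + 2) (y + 1) ((1 + C r * X) * p)
        + rowPairing (n + 1) (y + 1) (C (y + 1 + r) * p - C r * (X * derivative p)) := by
  induction p using Polynomial.induction_on' with
  | add p q hp hq =>
    simp only [mul_add, map_add, map_sub] at hp hq ⊢
    linear_combination hp + hq
  | monomial i a =>
    have shift := eval_add_one_rowPoly_succ (n + 1) i y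
    have shift_succ := eval_add_one_rowPoly_succ (n + 1) (i + 1) y
    have recurrence := congrArg (eval (y + 1)) (rowPoly_add_two n (i + 1))
    have euler : X * derivative (monomial i a) = monomial i (i * a) := by
      cases i <;> simp [X_mul_monomial, mul_comm]
    rw [euler]
    simp only [eval_add, eval_mul, eval_C, eval_X] at recurrence
    simp only [add_mul, one_mul, mul_assoc, X_mul_monomial, C_mul_monomial, map_add, map_sub,
      rowPairing_monomial, Nat.cast_succ]
    ring_nf at recurrence shift shift_succ ⊢
    linear_combination a * (recurrence - shift - (r + 1) * shift_succ)

section LinearProd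

variable {ι R : Type*} [Fintype ι]

/-- The generating polynomial `∏_k (1 + s_k X)` of the elementary symmetric functions of `s`. -/
noncomputable def linearProd [CommSemiring R] (s : ι → R) : R[X] :=
  ∏ k, (1 + C (s k) * X)

variable [CommSemiring R]

theorem linearProd_cons {n : ℕ} (c : R) (s : Fin n → R) :
    linearProd (Fin.cons c s : Fin (n + 1) → R) = (1 + C c * X) * linearProd s := by
  simp [linearProd, Fin.prod_univ_succ]

theorem linearProd_update [DecidableEq ι] (s : ι → R) (i : ι) (x : R) :
    linearProd (Function.update s i x)
      = (1 + C x * X) * ∏ k ∈ Finset.univ.erase i, (1 + C (s k) * X) := by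
  rw [linearProd, ← Finset.mul_prod_erase _ _ (Finset.mem_univ i), Function.update_self]
  congr 1
  refine Finset.prod_congr rfl fun k hk => ?_
  rw [Function.update_of_ne (Finset.ne_of_mem_erase hk)]

theorem derivative_linearProd [DecidableEq ι] (s : ι → R) :
    derivative (linearProd s)
      = ∑ i, C (s i) * ∏ k ∈ Finset.univ.erase i, (1 + C (s k) * X) := by
  rw [linearProd, derivative_prod_finset]
  refine Finset.sum_congr rfl fun i _ => ?_
  rw [mul_comm]
  simp

theorem coeff_zero_linearProd (s : ι → R) : (linearProd s).coeff 0 = 1 := by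
  simp [linearProd, coeff_zero_eq_eval_zero, eval_prod]

theorem coeff_one_linearProd (s : ι → R) : (linearProd s).coeff 1 = ∑ k, s k := by
  classical
  have h : (derivative (linearProd s)).coeff 0 = ∑ k, s k := by
    simp [derivative_linearProd, coeff_zero_eq_eval_zero, eval_finsetSum, eval_prod]
  simpa [coeff_derivative] using h

theorem natDegree_linearProd_le (s : ι → R) : (linearProd s).natDegree ≤ Fintype.card ι := by
  refine (natDegree_prod_le _ _).trans ?_
  refine (Finset.sum_le_card_nsmul _ _ 1 fun k _ => ?_).trans (by simp)
  compute_degree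

theorem coeff_linearProd_eq_zero (s : ι → R) {j : ℕ} (hj : Fintype.card ι < j) :
    (linearProd s).coeff j = 0 :=
  coeff_eq_zero_of_natDegree_lt ((natDegree_linearProd_le s).trans_lt hj)

theorem sum_mul_linearProd_update [DecidableEq ι] (r : R) (s : ι → R) :
    ∑ i, C (s i) * linearProd (Function.update s i (r + s i))
      = C (∑ i, s i) * linearProd s + C r * (X * derivative (linearProd s)) := by
  rw [derivative_linearProd, map_sum, Finset.sum_mul, Finset.mul_sum, Finset.mul_sum,
    ← Finset.sum_add_distrib]
  refine Finset.sum_congr rfl fun i _ => ?_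
  have hs := linearProd_update s i (s i)
  rw [Function.update_eq_self] at hs
  rw [linearProd_update, hs, map_add]
  ring

end LinearProd

theorem coeff_specializedU_recursion {ι : Type*} [Fintype ι] [DecidableEq ι] (m : ℕ) (r : ℤ)
    (s : ι → ℤ) :
    PowerSeries.coeff (m + 1) (specializedU ((1 + C (r + 1) * X) * linearProd s).coeff)
      = PowerSeries.coeff (m + 1) (specializedU ((1 + C r * X) * linearProd s).coeff)
        - ∑ i, s i * PowerSeries.coeff m
            (specializedU (linearProd (Function.update s i (r + s i))).coeff) := by
  have hcons (c : ℤ) : ((1 + C c * X) * linearProd s).coeff 1 = c + ∑ i, s i := by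
    simp [mul_coeff_one, coeff_zero_linearProd, coeff_one_linearProd, add_comm, coeff_one]
  cases m with
  | zero =>
    have hcoeff (c : ℤ) : ((1 + C c * X) * linearProd s).coeff 2
        = (linearProd s).coeff 2 + c * ∑ i, s i := by
      rw [add_mul, one_mul, mul_assoc, coeff_add, coeff_C_mul, coeff_X_mul, coeff_one_linearProd]
    simp only [zero_add, coeff_one_specializedU, coeff_zero_specializedU, hcoeff, mul_one]
    ring
  | succ m =>
    have hupdate (i : ι) :
        (linearProd (Function.update s i (r + s i))).coeff 1 = r + ∑ i, s i := by
      rw [coeff_one_linearProd, Finset.sum_update_of_mem (Finset.mem_univ i), add_assoc,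
        Finset.sdiff_singleton_eq_erase, Finset.add_sum_erase _ s (Finset.mem_univ i)]
    simp only [coeff_succ_specializedU, hcons, hupdate]
    have hsum : ∑ i, s i * rowPairing (m + 1) (-(r + ∑ i, s i))
          (linearProd (Function.update s i (r + s i)))
        = rowPairing (m + 1) (-(r + ∑ i, s i))
          (C (∑ i, s i) * linearProd s + C r * (X * derivative (linearProd s))) := by
      rw [← sum_mul_linearProd_update, map_sum]
      exact Finset.sum_congr rfl fun i _ => by rw [← smul_eq_C_mul, map_smul, smul_eq_mul]
    have key := rowPairing_add_two m r (-(r + 1 + ∑ i, s i)) (linearProd s)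
    rw [show -(r + 1 + ∑ i, s i) + 1 = -(r + ∑ i, s i) by ring,
      show -(r + ∑ i, s i) + r = -∑ i, s i by ring, map_neg, neg_mul, ← neg_add', map_neg,
      ← hsum] at key
    rw [key]
    simp only [mul_neg, Finset.sum_neg_distrib]
    ring

/-- The homogenization `N^d U(N⁻¹, σ_1, σ_2, …)` of `U`, as a polynomial in `N`. Terms of degree
greater than `d` in `x` are cut off; there are none if `σ_j = 0` for all `j > d`. -/
noncomputable def packingPoly (d : ℕ) (σ : ℕ → ℤ) : ℤ[X] :=
  ∑ m ∈ Finset.range (d + 1), C (PowerSeries.coeff m (specializedU σ)) * X ^ (d - m)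

theorem degree_packingPoly (d : ℕ) (σ : ℕ → ℤ) : (packingPoly d σ).degree = d := by
  have hlower : (∑ m ∈ Finset.range d,
      C (PowerSeries.coeff (m + 1) (specializedU σ)) * X ^ (d - (m + 1))).degree
        < (d : WithBot ℕ) := by
    refine (degree_sum_le _ _).trans_lt ((Finset.sup_lt_iff (WithBot.bot_lt_coe d)).2 ?_)
    refine fun m hm => (degree_C_mul_X_pow_le _ _).trans_lt ?_
    rw [Finset.mem_range] at hm
    exact Nat.cast_lt.2 (by omega)
  rw [packingPoly, Finset.sum_range_succ', coeff_zero_specializedU, map_one, one_mul, Nat.sub_zero,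
    degree_add_eq_right_of_degree_lt (by rwa [degree_X_pow]), degree_X_pow]

theorem aeval_packingPoly {d : ℕ} {σ : ℕ → ℤ} (hσ : ∀ j, d < j → σ j = 0) {x : ℝ} (hx : x ≠ 0) :
    aeval x (packingPoly d σ) = x ^ d * evalU x⁻¹ σ := by
  rw [evalU, tsum_eq_sum (s := Finset.range (d + 1)), packingPoly, map_sum, Finset.mul_sum]
  · refine Finset.sum_congr rfl fun m hm => ?_
    rw [map_mul, aeval_C, map_pow, aeval_X, pow_sub₀ _ hx (Finset.mem_range_succ_iff.1 hm), inv_pow,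
      eq_intCast]
    ring
  · intro m hm
    have hm : d < m := by simpa using hm
    rw [coeff_specializedU_eq_zero (by omega) fun j hj => hσ j (hm.trans hj), Int.cast_zero,
      zero_mul]

theorem packingPoly_succ {d : ℕ} {σ : ℕ → ℤ} (hσ : ∀ j, d < j → σ j = 0) :
    packingPoly (d + 1) σ = X * packingPoly d σ := by
  rw [packingPoly, Finset.sum_range_succ,
    coeff_specializedU_eq_zero d.succ_ne_zero fun j hj => hσ j (by omega), map_zero, zero_mul,
    add_zero, packingPoly, Finset.mul_sum]
  refine Finset.sum_congr rfl fun m hm => ?_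
  rw [Nat.succ_sub (Finset.mem_range_succ_iff.1 hm), pow_succ]
  ring

theorem packingPoly_recursion {ι : Type*} [Fintype ι] [DecidableEq ι] (d : ℕ) (r : ℤ) (s : ι → ℤ) :
    packingPoly (d + 1) ((1 + C (r + 1) * X) * linearProd s).coeff
      = packingPoly (d + 1) ((1 + C r * X) * linearProd s).coeff
        - ∑ i, C (s i) * packingPoly d (linearProd (Function.update s i (r + s i))).coeff := by
  simp only [packingPoly, Finset.mul_sum]
  rw [Finset.sum_comm, Finset.sum_range_succ', Finset.sum_range_succ' _ (d + 1),
    coeff_zero_specializedU, coeff_zero_specializedU, add_sub_right_comm, ← Finset.sum_sub_distrib]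
  congr 1
  refine Finset.sum_congr rfl fun m _ => ?_
  simp only [coeff_specializedU_recursion, Nat.add_sub_add_right, map_sub, map_sum, map_mul,
    sub_mul, Finset.sum_mul, mul_assoc]

end Algebra

section Group

open Polynomial

variable {G : Type*} [Group G] {m n : ℕ} {S : Fin n → Set G} {A S₀ : Set G} {a b g₀ : G}
  {g : Fin n → G}

theorem inv_mul_mem (ha : a ∈ A) (hb : b ∈ A) : a⁻¹ * b ∈ A⁻¹ * A :=
  Set.mul_mem_mul (Set.inv_mem_inv.2 ha) hb

theorem IsGeneric.eq_one_of_prod_eq_one (hS : IsGeneric S) {l : List (Fin n)} (hl : l.Nodup)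
    {h : Fin n → G} (hh : ∀ i ∈ l, h i ∈ (S i)⁻¹ * S i) (hprod : (l.map h).prod = 1) :
    ∀ i ∈ l, h i = 1 := by
  classical
  have hempty : l.filter (h · != 1) = [] := by
    by_contra hne
    refine hS _ hne (hl.filter _) h (fun i hi => ?_) ?_
    · rw [List.mem_filter, bne_iff_ne] at hi
      exact ⟨hh i hi.1, hi.2⟩
    · rwa [← List.prod_filter_bne_one, List.filter_map] at hprod
  simpa using hempty

theorem IsGeneric.of_prod_fibers {T : Fin m → Set G} (hT : IsGeneric T) (π : Fin m → Fin n)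
    (hS : ∀ j, ∀ x ∈ (S j)⁻¹ * S j, ∃ (e : List (Fin m)) (f : Fin m → G), e.Nodup ∧
      (∀ k ∈ e, π k = j ∧ f k ∈ (T k)⁻¹ * T k) ∧ (e.map f).prod = x) :
    IsGeneric S := by
  intro l hne hl h hh hprod
  have hfactor (j : Fin n) : ∃ (e : List (Fin m)) (f : Fin m → G), j ∈ l → e.Nodup ∧
      (∀ k ∈ e, π k = j ∧ f k ∈ (T k)⁻¹ * T k) ∧ (e.map f).prod = h j := by
    by_cases hj : j ∈ l
    · simpa [hj] using hS j (h j) (hh j hj).1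
    · exact ⟨[], 1, fun hj' => absurd hj' hj⟩
  choose e f hef using hfactor
  let F (k : Fin m) : G := f (π k) k
  have hmap (j : Fin n) (hj : j ∈ l) : ((e j).map F).prod = h j := by
    rw [← (hef j hj).2.2]
    refine congrArg List.prod (List.map_congr_left fun k hk => ?_)
    simp only [F, ((hef j hj).2.1 k hk).1]
  have hone : ∀ k ∈ l.flatMap e, F k = 1 := by
    refine hT.eq_one_of_prod_eq_one (List.nodup_flatMap.2 ⟨fun j hj => (hef j hj).1, ?_⟩) ?_ ?_
    · refine hl.imp_of_mem fun {i j} hi hj hij k hki hkj => hij ?_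
      rw [← ((hef i hi).2.1 k hki).1, ((hef j hj).2.1 k hkj).1]
    · intro k hk
      obtain ⟨j, hj, hkj⟩ := List.mem_flatMap.1 hk
      obtain ⟨rfl, hfk⟩ := (hef j hj).2.1 k hkj
      exact hfk
    · rw [List.map_flatMap, List.flatMap, List.prod_flatten, List.map_map, ← hprod]
      exact congrArg List.prod (List.map_congr_left hmap)
  obtain ⟨j, hj⟩ := List.exists_mem_of_ne_nil l hne
  refine (hh j hj).2 ?_
  rw [Set.mem_singleton_iff, ← hmap j hj]
  exact List.prod_eq_one (by simpa using fun k hk => hone k (List.mem_flatMap.2 ⟨j, hj, hk⟩))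

theorem IsGeneric.mono {T : Fin n → Set G} (hT : IsGeneric T) (hST : ∀ i, S i ⊆ T i) :
    IsGeneric S :=
  hT.of_prod_fibers id fun j x hx => ⟨[j], fun _ => x, by simp,
    by simpa using Set.mul_subset_mul (Set.inv_subset_inv.2 (hST j)) (hST j) hx, by simp⟩

theorem IsGeneric.tail (hS : IsGeneric (Fin.cons S₀ S : Fin (n + 1) → Set G)) : IsGeneric S := by
  intro l hne hl h hh
  have := hS (l.map Fin.succ) (by simpa using hne) (hl.map (Fin.succ_injective n))
    (Fin.cons 1 h) (by simpa using hh)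
  simpa [Function.comp_def] using this

theorem IsGeneric.update (hS : IsGeneric (Fin.cons S₀ S : Fin (n + 1) → Set G)) (i : Fin n)
    {T : Set G}
    (hT : T⁻¹ * T ⊆ (S₀⁻¹ * S₀) * ((S i)⁻¹ * S i) ∪ ((S i)⁻¹ * S i) * (S₀⁻¹ * S₀)) :
    IsGeneric (Function.update S i T) := by
  refine hS.of_prod_fibers (Fin.cons i id) fun j x hx => ?_
  obtain rfl | hj := eq_or_ne j i
  · rw [Function.update_self] at hx
    obtain ⟨u, hu, v, hv, rfl⟩ | ⟨v, hv, u, hu, rfl⟩ := hT hx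
    · exact ⟨[0, j.succ], Fin.cons u fun _ => v, by simp [(Fin.succ_ne_zero j).symm],
        by simpa using ⟨hu, hv⟩, by simp⟩
    · exact ⟨[j.succ, 0], Fin.cons u fun _ => v, by simp, by simpa using ⟨hv, hu⟩, by simp⟩
  · rw [Function.update_of_ne hj] at hx
    exact ⟨[j.succ], fun _ => x, by simp, by simpa using hx, by simp⟩

/-- The union of `S₁` and the left translate of `A` by the element taking `a` to `b`. It stands in
for `S₁` once `A ∪ {a}` and `S₁` have been placed so that `a` and `b` coincide. -/
def glue (A S₁ : Set G) (a b : G) : Set G :=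
  S₁ ∪ (b * a⁻¹) • A

theorem inv_mul_glue_subset {S₁ : Set G} (ha : a ∈ S₀) (hA : A ⊆ S₀) (hb : b ∈ S₁) :
    (glue A S₁ a b)⁻¹ * glue A S₁ a b
      ⊆ (S₀⁻¹ * S₀) * (S₁⁻¹ * S₁) ∪ (S₁⁻¹ * S₁) * (S₀⁻¹ * S₀) := by
  rw [Set.mul_subset_iff]
  intro x hx y hy
  rw [← inv_inv x]
  rw [Set.mem_inv] at hx
  generalize x⁻¹ = x at hx
  obtain hx | ⟨c, hc, rfl⟩ := hx <;> obtain hy | ⟨d, hd, rfl⟩ := hy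
  · exact .inl ⟨_, inv_mul_mem ha ha, _, inv_mul_mem hx hy, by simp⟩
  · exact .inr ⟨_, inv_mul_mem hx hb, _, inv_mul_mem ha (hA hd), by simp [mul_assoc]⟩
  · exact .inl ⟨_, inv_mul_mem (hA hc) ha, _, inv_mul_mem hb hy, by simp [mul_assoc]⟩
  · exact .inl ⟨_, inv_mul_mem (hA hc) (hA hd), _, inv_mul_mem hb hb, by simp [mul_assoc]⟩

theorem IsGeneric.update_glue (hS : IsGeneric (Fin.cons (insert a A) S : Fin (n + 1) → Set G))
    {i : Fin n} (hb : b ∈ S i) : IsGeneric (Function.update S i (glue A (S i) a b)) :=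
  hS.update i (inv_mul_glue_subset (Set.mem_insert a A) (Set.subset_insert a A) hb)

theorem IsGeneric.disjoint_glue (hS : IsGeneric (Fin.cons (insert a A) S : Fin (n + 1) → Set G))
    {i : Fin n} (ha : a ∉ A) (hb : b ∈ S i) : Disjoint (S i) ((b * a⁻¹) • A) := by
  rw [Set.disjoint_right]
  rintro _ ⟨c, hc, rfl⟩ hd
  have hone := hS.eq_one_of_prod_eq_one (l := [i.succ, 0]) (by simp)
    (h := Fin.cons (c⁻¹ * a) fun _ => b⁻¹ * (b * a⁻¹ * c))
    (List.forall_mem_cons.2 ⟨inv_mul_mem hb hd, List.forall_mem_singleton.2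
      (inv_mul_mem (Set.mem_insert_of_mem a hc) (Set.mem_insert a A))⟩)
    (by simp [mul_assoc]) 0 (by simp)
  exact ha (inv_mul_eq_one.1 hone ▸ hc)

theorem IsGeneric.ncard_glue [Finite G]
    (hS : IsGeneric (Fin.cons (insert a A) S : Fin (n + 1) → Set G)) {i : Fin n} (ha : a ∉ A)
    (hb : b ∈ S i) : (glue A (S i) a b).ncard = A.ncard + (S i).ncard := by
  rw [glue, Set.ncard_union_eq (hS.disjoint_glue ha hb), Set.ncard_smul_set, add_comm]

theorem isPacking_cons : IsPacking (Fin.cons A S : Fin (n + 1) → Set G) (Fin.cons g₀ g) ↔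
    IsPacking S g ∧ ∀ i, Disjoint (g₀ • A) (g i • S i) := by
  simp only [IsPacking, pairwise_fin_succ_iff, Fin.cons_zero, Fin.cons_succ,
    disjoint_comm (b := g₀ • A)]
  tauto

theorem isPacking_cons_insert :
    IsPacking (Fin.cons (insert a A) S : Fin (n + 1) → Set G) (Fin.cons g₀ g) ↔
      IsPacking (Fin.cons A S : Fin (n + 1) → Set G) (Fin.cons g₀ g) ∧
        ¬∃ i, g₀ * a ∈ g i • S i := by
  simp only [isPacking_cons, Set.smul_set_insert, Set.disjoint_insert_left, forall_and, not_exists,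
    smul_eq_mul]
  tauto

theorem isPacking_update_union {i : Fin n} {B : Set G} :
    IsPacking (Function.update S i (S i ∪ B)) g ↔
      IsPacking S g ∧ ∀ j, j ≠ i → Disjoint (g i • B) (g j • S j) := by
  constructor
  · intro h
    have hsub (j : Fin n) : g j • S j ⊆ g j • Function.update S i (S i ∪ B) j := by
      obtain rfl | hj := eq_or_ne j i <;> simp [*, Set.smul_set_union]
    refine ⟨fun j k hjk => (h hjk).mono (hsub j) (hsub k), fun j hj => ?_⟩
    have := h hj.symm
    simp only [Function.update_self, Function.update_of_ne hj, Set.smul_set_union,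
      Set.disjoint_union_left] at this
    exact this.2
  · rintro ⟨hS, hB⟩ j k hjk
    obtain rfl | hj := eq_or_ne j i
    · simpa [hjk.symm, Set.smul_set_union] using ⟨hS hjk, hB k hjk.symm⟩
    obtain rfl | hk := eq_or_ne k i
    · simpa [hj, Set.smul_set_union] using ⟨hS hjk, (hB j hj).symm⟩
    · simpa [hj, hk] using hS hjk

theorem isPacking_update_glue {i : Fin n} (h : Disjoint (S i) ((b * a⁻¹) • A)) :
    IsPacking (Function.update S i (glue A (S i) a b)) g ↔
      IsPacking (Fin.cons A S : Fin (n + 1) → Set G) (Fin.cons (g i * (b * a⁻¹)) g) := by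
  rw [glue, isPacking_update_union, isPacking_cons, smul_smul]
  refine and_congr_right fun _ => ⟨fun hB j => ?_, fun hB j _ => hB j⟩
  obtain rfl | hj := eq_or_ne j i
  · rw [mul_smul, Set.disjoint_smul_set]
    exact h.symm
  · exact hB j hj

theorem numPackings_cons_empty (S : Fin n → Set G) :
    numPackings (Fin.cons ∅ S : Fin (n + 1) → Set G) = Nat.card G * numPackings S := by
  have htail (g : Fin (n + 1) → G) :
      IsPacking (Fin.cons ∅ S : Fin (n + 1) → Set G) g ↔ IsPacking S (Fin.tail g) := by
    rw [← Fin.cons_self_tail g, isPacking_cons]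
    simp
  rw [numPackings, numPackings, ← Nat.card_prod]
  exact Nat.card_congr
    { toFun := fun g => (g.1 0, ⟨Fin.tail g.1, (htail g.1).1 g.2⟩)
      invFun := fun p => ⟨Fin.cons p.1 p.2.1, (htail _).2 p.2.2⟩
      left_inv := fun g => Subtype.ext (Fin.cons_self_tail g.1)
      right_inv := fun _ => rfl }

/-- The packings of `A, S_1, …, S_n` that are not packings of `A ∪ {a}, S_1, …, S_n`. -/
abbrev CollidingPacking (a : G) (A : Set G) (S : Fin n → Set G) : Type _ :=
  {g : Fin (n + 1) → G // IsPacking (Fin.cons A S : Fin (n + 1) → Set G) g ∧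
    ∃ i, g 0 * a ∈ g i.succ • S i}

theorem numPackings_cons_eq_add [Finite G] (a : G) (A : Set G) (S : Fin n → Set G) :
    numPackings (Fin.cons A S : Fin (n + 1) → Set G)
      = numPackings (Fin.cons (insert a A) S : Fin (n + 1) → Set G)
        + Nat.card (CollidingPacking a A S) := by
  classical
  have hinsert (g : Fin (n + 1) → G) :
      IsPacking (Fin.cons (insert a A) S : Fin (n + 1) → Set G) g ↔
        IsPacking (Fin.cons A S : Fin (n + 1) → Set G) g ∧ ¬∃ i, g 0 * a ∈ g i.succ • S i := by
    rw [← Fin.cons_self_tail g]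
    exact isPacking_cons_insert
  simp only [numPackings, hinsert, add_comm]
  rw [← Nat.card_sum]
  let Collides (g : Fin (n + 1) → G) : Prop := ∃ i, g 0 * a ∈ g i.succ • S i
  exact Nat.card_congr ((Equiv.sumCompl fun g => Collides g.1).symm.trans
    ((Equiv.subtypeSubtypeEquivSubtypeInter _ Collides).sumCongr
      (Equiv.subtypeSubtypeEquivSubtypeInter _ fun g => ¬Collides g)))

theorem IsPacking.eq_of_mul_eq (h : IsPacking S g) {i j : Fin n} {c : G} (hb : b ∈ S i)
    (hc : c ∈ S j) (hbc : g i * b = g j * c) : i = j := by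
  by_contra hij
  refine Set.disjoint_left.1 (h hij) (Set.smul_mem_smul_set hb) ?_
  rw [smul_eq_mul, hbc]
  exact Set.smul_mem_smul_set hc

theorem card_collidingPacking [Finite G] [∀ i, Fintype (S i)]
    (h : ∀ i, ∀ b ∈ S i, Disjoint (S i) ((b * a⁻¹) • A)) :
    Nat.card (CollidingPacking a A S)
      = ∑ i, ∑ b : S i, numPackings (Function.update S i (glue A (S i) a b)) := by
  simp only [numPackings, ← Nat.card_sigma]
  symm
  let place (p : Σ i, Σ b : S i, {g // IsPacking (Function.update S i (glue A (S i) a b)) g}) :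
      CollidingPacking a A S :=
    ⟨Fin.cons (p.2.2.1 p.1 * (p.2.1 * a⁻¹)) p.2.2.1,
      (isPacking_update_glue (h _ _ p.2.1.2)).1 p.2.2.2, p.1, by
        simpa [mul_assoc] using Set.smul_mem_smul_set (a := p.2.2.1 p.1) p.2.1.2⟩
  refine Nat.card_eq_of_bijective place ⟨?_, ?_⟩
  · rintro ⟨i, ⟨b, hb⟩, g, hg⟩ ⟨j, ⟨c, hc⟩, g', hg'⟩ hgg'
    obtain ⟨heq, rfl⟩ := (Fin.cons_inj (α := fun _ => G)).1 (Subtype.ext_iff.1 hgg')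
    simp only [← mul_assoc, mul_left_inj] at heq
    obtain rfl := (isPacking_update_union.1 hg).1.eq_of_mul_eq hb hc heq
    obtain rfl := mul_left_cancel heq
    rfl
  · rintro ⟨g, hg, i, b, hb, hgb⟩
    have hg₀ : g 0 = g i.succ * (b * a⁻¹) := by
      simpa [← mul_assoc, eq_mul_inv_iff_mul_eq] using hgb.symm
    refine ⟨⟨i, ⟨b, hb⟩, Fin.tail g, (isPacking_update_glue (h i b hb)).2 ?_⟩, Subtype.ext ?_⟩
    all_goals simp only [Fin.tail, place, ← hg₀]
    · exact (Fin.cons_self_tail g).symm ▸ hg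
    · exact Fin.cons_self_tail g

theorem card_collidingPacking_eq_eval [Finite G] (ih : ∀ T : Fin n → Set G, IsGeneric T →
      (numPackings T : ℤ)
        = (packingPoly n (linearProd fun i => ((T i).ncard : ℤ)).coeff).eval (Nat.card G : ℤ))
    (hS : IsGeneric (Fin.cons (insert a A) S : Fin (n + 1) → Set G)) (ha : a ∉ A) :
    (Nat.card (CollidingPacking a A S) : ℤ)
      = ∑ i, (S i).ncard * (packingPoly n (linearProd (Function.update
          (fun i => ((S i).ncard : ℤ)) i (A.ncard + (S i).ncard))).coeff).eval
            (Nat.card G : ℤ) := by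
  classical
  have := Fintype.ofFinite G
  rw [card_collidingPacking fun i b hb => hS.disjoint_glue ha hb, Nat.cast_sum]
  refine Finset.sum_congr rfl fun i _ => ?_
  rw [Nat.cast_sum, ← Nat.card_coe_set_eq, Nat.card_eq_fintype_card, ← nsmul_eq_mul]
  refine Finset.sum_eq_card_nsmul fun b _ => ?_
  rw [ih _ (hS.update_glue b.2)]
  congr 4
  funext j
  rw [Function.apply_update fun _ T => (Set.ncard T : ℤ), hS.ncard_glue ha b.2, Nat.cast_add,
    ← Nat.card_eq_fintype_card, Nat.card_coe_set_eq]

theorem numPackings_cons_eq_eval [Finite G] (ih : ∀ T : Fin n → Set G, IsGeneric T →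
      (numPackings T : ℤ)
        = (packingPoly n (linearProd fun i => ((T i).ncard : ℤ)).coeff).eval (Nat.card G : ℤ))
    (hS : IsGeneric (Fin.cons S₀ S : Fin (n + 1) → Set G)) :
    (numPackings (Fin.cons S₀ S : Fin (n + 1) → Set G) : ℤ)
      = (packingPoly (n + 1) ((1 + C (S₀.ncard : ℤ) * X)
          * linearProd fun i => ((S i).ncard : ℤ)).coeff).eval (Nat.card G : ℤ) := by
  induction S₀, S₀.toFinite using Set.Finite.induction_on with
  | empty =>
    rw [numPackings_cons_empty, Set.ncard_empty, Nat.cast_zero, C_0, zero_mul, add_zero, one_mul,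
      packingPoly_succ, eval_mul, eval_X, ← ih S hS.tail, Nat.cast_mul]
    exact fun j hj => coeff_linearProd_eq_zero _ (by simpa using hj)
  | @insert a A ha _ ihA =>
    have hA := ihA (hS.mono (Fin.cases (Set.subset_insert a A) fun i => subset_rfl))
    rw [numPackings_cons_eq_add a, Nat.cast_add, card_collidingPacking_eq_eval ih hS ha] at hA
    rw [Set.ncard_insert_of_notMem ha, Nat.cast_succ, packingPoly_recursion, eval_sub, ← hA]
    simp [eval_finsetSum]

theorem numPackings_eq_eval [Finite G] (hS : IsGeneric S) :
    (numPackings S : ℤ)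
      = (packingPoly n (linearProd fun i => ((S i).ncard : ℤ)).coeff).eval (Nat.card G : ℤ) := by
  induction n with
  | zero =>
    have hall (g : Fin 0 → G) : IsPacking S g := fun i => i.elim0
    simp [numPackings, hall, packingPoly, coeff_zero_specializedU]
  | succ n ih =>
    rw [← Fin.cons_self_tail S] at hS ⊢
    rw [numPackings_cons_eq_eval @ih hS, ← linearProd_cons]
    congr 4
    funext i
    cases i using Fin.cases <;> rfl

end Group

theorem sigma_eq_zero {n : ℕ} (s : Fin n → ℕ) {j : ℕ} (hj : n < j) : sigma s j = 0 :=
  coeff_linearProd_eq_zero (fun k => (s k : ℤ)) (by simpa using hj)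

theorem eval_packingPoly_sigma {n : ℕ} (s : Fin n → ℕ) {N : ℕ} (hN : 0 < N) :
    (((packingPoly n (sigma s)).eval (N : ℤ) : ℤ) : ℝ) = N ^ n * evalU (N : ℝ)⁻¹ (sigma s) := by
  rw [← aeval_packingPoly (fun j => sigma_eq_zero s) (Nat.cast_ne_zero.2 hN.ne')]
  simpa using (Polynomial.aeval_algebraMap_apply ℝ (N : ℤ) (packingPoly n (sigma s))).symm

end GroupPacking

theorem theorem2p1 (n : ℕ) :
    (∀ (G : Type u) [Group G] [Finite G] (S : Fin n → Set G),
      (∀ i, (S i).Nonempty) → GroupPacking.IsGeneric S →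
        (GroupPacking.numPackings S : ℝ) =
          (Nat.card G : ℝ) ^ n *
            GroupPacking.evalU ((Nat.card G : ℝ)⁻¹)
              (GroupPacking.sigma fun i => (S i).ncard)) ∧
    (∀ s : Fin n → ℕ, (∀ i, 0 < s i) →
      (∀ m : ℕ, n ≤ m → m ≠ 0 →
        PowerSeries.coeff m (GroupPacking.specializedU (GroupPacking.sigma s)) = 0) ∧
      ∃ P : Polynomial ℤ, P.degree = n ∧
        (∀ N : ℕ, 0 < N →
          ((P.eval (N : ℤ) : ℤ) : ℝ) =
            (N : ℝ) ^ n * GroupPacking.evalU ((N : ℝ)⁻¹) (GroupPacking.sigma s)) ∧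
        ∀ (G : Type u) [Group G] [Finite G] (S : Fin n → Set G),
          (∀ i, (S i).ncard = s i) → GroupPacking.IsGeneric S →
            (GroupPacking.numPackings S : ℤ) = P.eval (Nat.card G : ℤ)) := by
  refine ⟨fun G _ _ S _ hS => ?_, fun s _ => ⟨fun m hnm hm => ?_,
    GroupPacking.packingPoly n (GroupPacking.sigma s), GroupPacking.degree_packingPoly n _,
    fun N hN => GroupPacking.eval_packingPoly_sigma s hN, fun G _ _ S hs hS => ?_⟩⟩
  · rw [← GroupPacking.eval_packingPoly_sigma _ Nat.card_pos]
    exact_mod_cast GroupPacking.numPackings_eq_eval hS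
  · exact GroupPacking.coeff_specializedU_eq_zero hm fun i hi =>
      GroupPacking.sigma_eq_zero s (hnm.trans_lt hi)
  · rw [← funext hs]
    exact GroupPacking.numPackings_eq_eval hS
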